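/- Theorem 4. Let $L\ge 0$, $G_\infty>0$, $0\le\beta_1<1$ and $\beta_2>0$. There are constants $C_1,C_2,C_3$, depending only on $L,G_\infty,\beta_1,\beta_2$, such that the following holds. Let $d\in\mathbb N$, $x_1\in\mathbb R^d$, $\alpha>0$, $c>0$, and let $f:\mathbb R^d\to\mathbb R$ be differentiable and bounded below, with $L$-Lipschitz gradient ($f$ need not be convex). Then there is a constant $C_4$, depending in addition only on $d,f,x_1,\alpha,c$ (in particular not on $T$), such that the following holds for all $\beta_{1,t}\in[0,\beta_1]$ ($t\ge1$). Consider AdaX on $\mathbb R^d$, started at the deterministic point $x_1$ with $m_0=v_0=0$, which at each step $t=1,2,\dots$ receives a random vector $g_t$ (a noisy gradient at $x_t$) and sets, with all operations on vectors taken coordinatewise, $$m_t=\beta_{1,t}m_{t-1}+(1-\beta_{1,t})g_t,\quad v_t=(1+\beta_2)v_{t-1}+\beta_2g_t^2,\quad \hat v_t=\frac{v_t}{(1+\beta_2)^t-1},\quad x_{t+1}=x_t-\alpha_t\frac{m_t}{\sqrt{\hat v_t}},\quad \alpha_t=\frac{\alpha}{\sqrt t}.$$ Assume that almost surely $\|\nabla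 f(x_t)\|\le G_\infty$ and $\|g_t\|\le G_\infty$ for all $t\ge1$; that the noise $\eta_t=g_t-\nabla f(x_t)$ satisfies $\mathbb E[\eta_t]=0$ for all $t\ge 1$ and that $\eta_1,\eta_2,\dots$ are independent; and that almost surely $\min_{1\le j\le d}\sqrt{(\hat v_1)_j}\ge c$. Then each $\mathbb E\|\nabla f(x_t)\|^2$ is finite, for every $T\ge1$ $$\min_{1\le t\le T}\mathbb E\|\nabla f(x_t)\|^2\le\frac{G_\infty}{\alpha\sqrt T}\left(\frac{C_1G_\infty^2\alpha^2}{c^2}(1+\log T)+\frac{C_2d\alpha}{c}+\frac{C_3d\alpha^2}{c^2}+C_4\right),$$ and consequently $\min_{1\le t\le T}\mathbb E\|\nabla f(x_t)\|^2=O(\log T/\sqrt T)$ as $T\to\infty$. -/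

import Mathlib

open MeasureTheory ProbabilityTheory Filter Asymptotics
open scoped NNReal Gradient

namespace AdaX

/-- The parameter space `ℝ^d` with its Euclidean norm. -/
abbrev Vec (d : ℕ) : Type := EuclideanSpace ℝ (Fin d)

variable {d : ℕ}

/-- First moments of AdaX, `m 0 = 0` and `m t = β₁ t • m (t-1) + (1 - β₁ t) • g t`, as a function
of the sequence `g 1, g 2, …` of gradients that the algorithm receives (`g 0` is never used). -/
noncomputable def firstMoment (β₁ : ℕ → ℝ) (g : ℕ → Vec d) : ℕ → Vec d
  | 0 => 0
  | t + 1 => β₁ (t + 1) • firstMoment β₁ g t + (1 - β₁ (t + 1)) • g (t + 1)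

/-- Second moments of AdaX, `v 0 = 0` and `v t = (1 + β₂) v (t-1) + β₂ (g t)²`,
with the coordinatewise square. -/
noncomputable def secondMoment (β₂ : ℝ) (g : ℕ → Vec d) : ℕ → Vec d
  | 0 => 0
  | t + 1 => WithLp.toLp 2 fun i =>
      (1 + β₂) * secondMoment β₂ g t i + β₂ * (g (t + 1) i) ^ 2

/-- Bias-corrected second moments `v̂ t = v t / ((1 + β₂)^t - 1)`, for `t ≥ 1`. -/
noncomputable def correctedSecondMoment (β₂ : ℝ) (g : ℕ → Vec d) (t : ℕ) : Vec d :=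
  WithLp.toLp 2 fun i => secondMoment β₂ g t i / ((1 + β₂) ^ t - 1)

/-- The iterates `x 1, x 2, …` of (unconstrained) AdaX started at `x 1 = x₁`, with step sizes `a t`:
`x (t+1) = x t - a t • m t / √(v̂ t)` coordinatewise, for `t ≥ 1`.  The iterate `x t` depends on
`g 1, …, g (t-1)` only.  (The value at index `0` is a placeholder and is never used.) -/
noncomputable def iterate (a β₁ : ℕ → ℝ) (β₂ : ℝ) (x₁ : Vec d) (g : ℕ → Vec d) : ℕ → Vec d
  | 0 => x₁
  | 1 => x₁
  | t + 2 => iterate a β₁ β₂ x₁ g (t + 1) - WithLp.toLp 2 fun i =>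
      a (t + 1) * firstMoment β₁ g (t + 1) i / √(correctedSecondMoment β₂ g (t + 1) i)

/-- The random iterate `x_t` of AdaX with step sizes `α / √t`, run on random gradients `g`. -/
noncomputable def randomIterate {Ω : Type*} (α : ℝ) (β₁ : ℕ → ℝ) (β₂ : ℝ) (x₁ : Vec d)
    (g : ℕ → Ω → Vec d) (t : ℕ) (ω : Ω) : Vec d :=
  iterate (fun s => α / √(s : ℝ)) β₁ β₂ x₁ (fun s => g s ω) t

/-- `min_{1 ≤ t ≤ T} 𝔼[‖∇ f (x_t)‖²]` (for `T ≥ 1`) for a random sequence `x`. -/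
noncomputable def minExpectedSqGrad {Ω : Type*} [MeasurableSpace Ω] (μ : Measure Ω)
    (f : Vec d → ℝ) (x : ℕ → Ω → Vec d) (T : ℕ) : ℝ :=
  ⨅ t : Finset.Icc 1 T, ∫ ω, ‖∇ f (x t ω)‖ ^ 2 ∂μ

end AdaX

/-! Write `D n` for the diagonal step `α / (√n √(v̂ n))`, with `D 0 = α / c`, and `Δ n = D n * m n`,
so that `x (n+1) = x n - Δ n`. Two facts about `v̂` drive the proof. Bernoulli's inequality makes `n
* v̂ n` nondecreasing, so `D` decreases in each coordinate. The first gradient keeps at least the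
fraction `β₂ / (1 + β₂)` of its weight, so `v̂ n` stays above a fixed multiple of `c²` and `∑ ‖Δ
n‖²` grows at most like a harmonic sum. This is where `log T` comes from.

By smoothness, `∑ ⟪∇f(x n), Δ n⟫` is at most `f x₁ - inf f` plus a multiple of `∑ ‖Δ n‖²`. For the
lower bound, the momentum is unrolled by `recurrence_inner_gradient_displacement` and
`exists_weights_of_recurrence`, leaving a weighted sum of `∑ᵢ ∇f(x (n+1))ᵢ * D n i * g (n+1) i`.
Using the old step `D n` rather than `D (n+1)` costs only a telescoping error, and it makes the
factor in front of `g (n+1)` a function of the past noise. In expectation the independent centred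
noise therefore drops out (`le_integral_scaledInner`). What remains is at least `α / (G √(n+1)) *
𝔼‖∇f(x (n+1))‖²`, because `v̂ ≤ G²`. Bounding each of the `T` terms below by the minimum yields the
factor `√T`. -/

namespace AdaX

/-! ### Smoothness, weights for a linear recurrence, and the harmonic sum -/

section Auxiliary

/-- A Lipschitz gradient gives a quadratic upper bound. -/
theorem le_add_inner_gradient_add {E : Type*} [NormedAddCommGroup E] [InnerProductSpace ℝ E]
    [CompleteSpace E] {f : E → ℝ} {L : ℝ≥0} (hf : Differentiable ℝ f)
    (hL : LipschitzWith L (∇ f)) (x y : E) :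
    f y ≤ f x + inner ℝ (∇ f x) (y - x) + L * ‖y - x‖ ^ 2 := by
  -- The mean value theorem gives `L` in place of the sharp `L / 2`; this only affects the size of
  -- `C₁`.
  obtain ⟨z, hz, h⟩ := domain_mvt (f := f) (s := Set.univ) (x := x) (y := y)
    (f' := fun z => InnerProductSpace.toDual ℝ E (∇ f z))
    (fun z _ => (hf z).hasGradientAt.hasFDerivAt.hasFDerivWithinAt)
    convex_univ (Set.mem_univ _) (Set.mem_univ _)
  rw [InnerProductSpace.toDual_apply_apply] at h
  have hzx : ‖z - x‖ ≤ ‖y - x‖ := by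
    rw [segment_eq_image'] at hz
    obtain ⟨θ, ⟨h0, h1⟩, rfl⟩ := hz
    simp only [add_sub_cancel_left, norm_smul, Real.norm_eq_abs, abs_of_nonneg h0]
    exact mul_le_of_le_one_left (norm_nonneg _) h1
  have h1 : inner ℝ (∇ f z - ∇ f x) (y - x) ≤ L * ‖y - x‖ ^ 2 := by
    refine (real_inner_le_norm _ _).trans ?_
    have h2 := hL.dist_le_mul z x
    rw [dist_eq_norm, dist_eq_norm] at h2
    have h3 : ‖∇ f z - ∇ f x‖ ≤ L * ‖y - x‖ := h2.trans (by gcongr)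
    calc _ ≤ (L * ‖y - x‖) * ‖y - x‖ := by gcongr
      _ = _ := by ring
  rw [inner_sub_left] at h1
  linarith

/-- Unrolling `A (n + 1) ≥ b n * A n + q n` and summing: the coefficients of the `q n` lie between
`1` and `1 / (1 - β)` when all `b n` lie in `[0, β]`. -/
theorem exists_weights_of_recurrence {β : ℝ} (hβ : 0 ≤ β) (hβ' : β < 1) (T : ℕ) :
    ∀ b : ℕ → ℝ, (∀ n, 0 ≤ b n ∧ b n ≤ β) →
    ∃ (u : ℕ → ℝ) (k : ℝ), (∀ n, 1 ≤ u n ∧ u n ≤ 1 / (1 - β)) ∧ (0 ≤ k ∧ k ≤ β / (1 - β)) ∧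
      ∀ A q : ℕ → ℝ, (∀ n, b n * A n + q n ≤ A (n + 1)) →
        k * A 0 + ∑ n ∈ Finset.range T, u n * q n ≤ ∑ n ∈ Finset.range T, A (n + 1) := by
  have h1 : 0 < 1 - β := by linarith
  induction T with
  | zero =>
    intro b _
    refine ⟨fun _ => 1, 0, fun _ => ⟨le_rfl, ?_⟩, ⟨le_rfl, by positivity⟩, by simp⟩
    rw [le_div_iff₀ h1]; linarith
  | succ T ih =>
    intro b hb
    obtain ⟨u, k, hu, hk, h⟩ := ih (fun n => b (n + 1)) fun n => hb (n + 1)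
    have hk1 : 1 + k ≤ 1 / (1 - β) := by
      have : 1 + β / (1 - β) = 1 / (1 - β) := by field_simp; ring
      linarith [hk.2]
    -- The weights are the truncated sums `u n = 1 + b (n+1) + b (n+1) * b (n+2) + ⋯`, dominated by
    -- a geometric series. They are chosen before `A` and `q`, so a single deterministic choice
    -- serves all sample paths and commutes with expectation.
    refine ⟨fun n => Nat.casesOn n (1 + k) u, (1 + k) * b 0, ?_, ⟨?_, ?_⟩, ?_⟩
    · rintro (_ | n)
      · exact ⟨le_add_of_nonneg_right hk.1, hk1⟩
      · exact hu n
    · exact mul_nonneg (by linarith [hk.1]) (hb 0).1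
    · calc (1 + k) * b 0 ≤ 1 / (1 - β) * β :=
            mul_le_mul hk1 (hb 0).2 (hb 0).1 (by positivity)
        _ = _ := by ring
    · intro A q hA
      have h2 := h (fun n => A (n + 1)) (fun n => q (n + 1)) fun n => hA (n + 1)
      rw [Finset.sum_range_succ', Finset.sum_range_succ' (fun n => A (n + 1))]
      have h3 := mul_le_mul_of_nonneg_left (hA 0) (show 0 ≤ 1 + k by linarith [hk.1])
      simp only [zero_add] at h2 h3 ⊢
      change (1 + k) * b 0 * A 0 + (∑ n ∈ Finset.range T, u n * q (n + 1) + (1 + k) * q 0) ≤ _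
      linarith

theorem sum_range_inv_le_one_add_log (T : ℕ) :
    ∑ n ∈ Finset.range T, ((n : ℝ) + 1)⁻¹ ≤ 1 + Real.log T := by
  have h := harmonic_le_one_add_log T
  simpa [harmonic] using h

end Auxiliary

/-! ### Pathwise analysis of AdaX -/

section Deterministic

variable {d : ℕ}

/-- The coordinatewise effective step sizes `α / (√n √(v̂ n))` of AdaX, with value `α / c` at
`n = 0`. -/
noncomputable def effectiveStep (α c β₂ : ℝ) (g : ℕ → Vec d) (n : ℕ) (i : Fin d) : ℝ :=
  if n = 0 then α / c else α / √(n : ℝ) / √(correctedSecondMoment β₂ g n i)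

/-- The displacement `effectiveStep n * firstMoment n` of the `n`-th AdaX step. -/
noncomputable def displacement (α c β₂ : ℝ) (β : ℕ → ℝ) (g : ℕ → Vec d) (n : ℕ) : Vec d :=
  WithLp.toLp 2 fun i => effectiveStep α c β₂ g n i * firstMoment β g n i

/-- Also valid at `n = 0`, whatever `c` is: the placeholder `x 0 = x₁` and `m 0 = 0` make step `0`
trivial, so the momentum recursion can start there. -/
theorem iterate_succ (α c β₂ : ℝ) (β : ℕ → ℝ) (x₁ : Vec d) (g : ℕ → Vec d) (n : ℕ) :
    iterate (fun s => α / √(s : ℝ)) β β₂ x₁ g (n + 1) =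
      iterate (fun s => α / √(s : ℝ)) β β₂ x₁ g n - displacement α c β₂ β g n := by
  cases n with
  | zero =>
    ext i
    simp [iterate, displacement, firstMoment]
  | succ n =>
    ext i
    simp only [iterate, displacement, effectiveStep, Nat.succ_ne_zero, if_false]
    simp only [PiLp.sub_apply]
    ring

theorem norm_firstMoment_le {G : ℝ} (hG : 0 ≤ G) {β : ℕ → ℝ}
    (hβ : ∀ t, 1 ≤ t → 0 ≤ β t ∧ β t ≤ 1) {g : ℕ → Vec d} (hg : ∀ t, 1 ≤ t → ‖g t‖ ≤ G) (n : ℕ) :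
    ‖firstMoment β g n‖ ≤ G := by
  induction n with
  | zero => simpa [firstMoment] using hG
  | succ n ih =>
    obtain ⟨h0, h1⟩ := hβ (n + 1) (by omega)
    have h2 := hg (n + 1) (by omega)
    rw [firstMoment]
    refine (norm_add_le _ _).trans ?_
    rw [norm_smul, norm_smul, Real.norm_of_nonneg h0, Real.norm_of_nonneg (by linarith)]
    have h3 := mul_le_mul_of_nonneg_left ih h0
    have h4 := mul_le_mul_of_nonneg_left h2 (show 0 ≤ 1 - β (n + 1) by linarith)
    linarith

/-! ### Bounds and monotonicity for the second moments -/

variable {β₂ : ℝ} {g : ℕ → Vec d}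

theorem secondMoment_nonneg (hβ₂ : 0 < β₂) (n : ℕ) (i : Fin d) :
    0 ≤ secondMoment β₂ g n i := by
  induction n with
  | zero => simp [secondMoment]
  | succ n ih =>
    simp only [secondMoment]
    positivity

theorem secondMoment_le (hβ₂ : 0 < β₂) {G : ℝ} (hg : ∀ t, 1 ≤ t → ‖g t‖ ≤ G) (n : ℕ)
    (i : Fin d) : secondMoment β₂ g n i ≤ ((1 + β₂) ^ n - 1) * G ^ 2 := by
  induction n with
  | zero => simp [secondMoment]
  | succ n ih =>
    simp only [secondMoment]
    have h1 : g (n + 1) i ^ 2 ≤ G ^ 2 := by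
      rw [← sq_abs]
      exact pow_le_pow_left₀ (abs_nonneg _)
        ((PiLp.norm_apply_le (g (n + 1)) i).trans (hg _ (by omega))) 2
    have h2 := mul_le_mul_of_nonneg_left ih (show 0 ≤ 1 + β₂ by linarith)
    have h3 := mul_le_mul_of_nonneg_left h1 hβ₂.le
    rw [pow_succ (1 + β₂)]
    linarith

theorem mul_pow_mul_sq_le_secondMoment (hβ₂ : 0 < β₂) (n : ℕ) (i : Fin d) :
    β₂ * (1 + β₂) ^ n * g 1 i ^ 2 ≤ secondMoment β₂ g (n + 1) i := by
  induction n with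
  | zero => simp [secondMoment]
  | succ n ih =>
    rw [secondMoment]
    have h2 := mul_le_mul_of_nonneg_left ih (show 0 ≤ 1 + β₂ by linarith)
    have h3 : 0 ≤ β₂ * g (n + 1 + 1) i ^ 2 := by positivity
    simp only [pow_succ] at h2 h3 ⊢
    linarith

theorem pow_sub_one_pos (hβ₂ : 0 < β₂) (n : ℕ) : 0 < (1 + β₂) ^ (n + 1) - 1 :=
  sub_pos.2 (one_lt_pow₀ (by linarith) (by omega))

theorem correctedSecondMoment_one (hβ₂ : 0 < β₂) (i : Fin d) :
    correctedSecondMoment β₂ g 1 i = g 1 i ^ 2 := by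
  simp [correctedSecondMoment, secondMoment, hβ₂.ne']

theorem correctedSecondMoment_le (hβ₂ : 0 < β₂) {G : ℝ} (hg : ∀ t, 1 ≤ t → ‖g t‖ ≤ G) (n : ℕ)
    (i : Fin d) : correctedSecondMoment β₂ g (n + 1) i ≤ G ^ 2 := by
  simp only [correctedSecondMoment]
  rw [div_le_iff₀ (pow_sub_one_pos hβ₂ n), mul_comm]
  exact secondMoment_le hβ₂ hg _ i

/-- Early gradients keep a positive weight in AdaX. -/
theorem le_correctedSecondMoment (hβ₂ : 0 < β₂) (n : ℕ) (i : Fin d) :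
    β₂ / (1 + β₂) * g 1 i ^ 2 ≤ correctedSecondMoment β₂ g (n + 1) i := by
  simp only [correctedSecondMoment]
  rw [le_div_iff₀ (pow_sub_one_pos hβ₂ n)]
  refine le_trans ?_ (mul_pow_mul_sq_le_secondMoment hβ₂ n i)
  have h : β₂ * (1 + β₂) ^ n * g 1 i ^ 2 =
      β₂ / (1 + β₂) * g 1 i ^ 2 * (1 + β₂) ^ (n + 1) := by
    field_simp
    ring
  rw [h]
  exact mul_le_mul_of_nonneg_left (by linarith) (by positivity)

/-- Since `v` grows at least by the factor `1 + β₂`, it suffices to compare the denominators. That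
comparison reduces to Bernoulli's inequality `1 + (n+2) β₂ ≤ (1 + β₂)^(n+2)`. The factor `n`
supplied by `α / √n` thus compensates for any decrease of `v̂`. -/
theorem mul_correctedSecondMoment_le_succ (hβ₂ : 0 < β₂) (n : ℕ) (i : Fin d) :
    ((n : ℝ) + 1) * correctedSecondMoment β₂ g (n + 1) i ≤
      ((n : ℝ) + 2) * correctedSecondMoment β₂ g (n + 2) i := by
  have hp := pow_sub_one_pos hβ₂ n
  have hp2 := pow_sub_one_pos hβ₂ (n + 1)
  have hv := secondMoment_nonneg (g := g) hβ₂ (n + 1) i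
  have hv2 : (1 + β₂) * secondMoment β₂ g (n + 1) i ≤ secondMoment β₂ g (n + 2) i := by
    have h : secondMoment β₂ g (n + 2) i =
        (1 + β₂) * secondMoment β₂ g (n + 1) i + β₂ * g (n + 2) i ^ 2 := rfl
    rw [h]
    exact le_add_of_nonneg_right (by positivity)
  simp only [correctedSecondMoment]
  rw [← mul_div_assoc, ← mul_div_assoc, div_le_div_iff₀ hp hp2]
  have hb := one_add_mul_le_pow (show (-2 : ℝ) ≤ β₂ by linarith) (n + 1)
  push_cast at hb
  have key : ((n : ℝ) + 1) * ((1 + β₂) ^ (n + 2) - 1) ≤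
      ((n : ℝ) + 2) * (1 + β₂) * ((1 + β₂) ^ (n + 1) - 1) := by
    rw [pow_succ _ (n + 1)]
    nlinarith
  calc _ = secondMoment β₂ g (n + 1) i * (((n : ℝ) + 1) * ((1 + β₂) ^ (n + 2) - 1)) := by ring
    _ ≤ secondMoment β₂ g (n + 1) i *
        (((n : ℝ) + 2) * (1 + β₂) * ((1 + β₂) ^ (n + 1) - 1)) := by gcongr
    _ = ((n : ℝ) + 2) * ((1 + β₂) * secondMoment β₂ g (n + 1) i) * ((1 + β₂) ^ (n + 1) - 1) := by
      ring
    _ ≤ _ := by gcongr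

/-! ### Effective steps and displacements -/

variable {α c : ℝ}

theorem correctedSecondMoment_pos (hβ₂ : 0 < β₂) (hc : 0 < c)
    (hgc : ∀ j, c ≤ √(correctedSecondMoment β₂ g 1 j)) (n : ℕ) (i : Fin d) :
    0 < correctedSecondMoment β₂ g (n + 1) i := by
  refine lt_of_lt_of_le ?_ (le_correctedSecondMoment hβ₂ n i)
  have := hgc i
  rw [correctedSecondMoment_one hβ₂, Real.sqrt_sq_eq_abs] at this
  have : g 1 i ≠ 0 := abs_pos.1 (hc.trans_le this)
  positivity

theorem effectiveStep_nonneg (hα : 0 < α) (hc : 0 < c) (n : ℕ) (i : Fin d) :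
    0 ≤ effectiveStep α c β₂ g n i := by
  unfold effectiveStep
  split_ifs <;> positivity

/-- For `n ≥ 1` this is the monotonicity of `n * v̂ n`; at `n = 0` it is the assumption `c ≤ √(v̂
1)`, which is why `α / c` is the right initial value. -/
theorem effectiveStep_succ_le (hβ₂ : 0 < β₂) (hα : 0 < α) (hc : 0 < c)
    (hgc : ∀ j, c ≤ √(correctedSecondMoment β₂ g 1 j)) (n : ℕ) (i : Fin d) :
    effectiveStep α c β₂ g (n + 1) i ≤ effectiveStep α c β₂ g n i := by
  cases n with
  | zero =>
    simp only [effectiveStep, if_true, Nat.succ_ne_zero, if_false]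
    norm_num
    have := hgc i
    gcongr
  | succ n =>
    simp only [effectiveStep, Nat.succ_ne_zero, if_false]
    have h1 := correctedSecondMoment_pos hβ₂ hc hgc n i
    rw [div_div, div_div, ← Real.sqrt_mul (by positivity), ← Real.sqrt_mul (by positivity)]
    have h2 := mul_correctedSecondMoment_le_succ (g := g) hβ₂ n i
    have h3 : 0 < √(((n + 1 : ℕ) : ℝ) * correctedSecondMoment β₂ g (n + 1) i) := by positivity
    gcongr α / √?_
    push_cast
    rw [add_assoc, one_add_one_eq_two]
    exact h2

theorem effectiveStep_le (hβ₂ : 0 < β₂) (hα : 0 < α) (hc : 0 < c)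
    (hgc : ∀ j, c ≤ √(correctedSecondMoment β₂ g 1 j)) (n : ℕ) (i : Fin d) :
    effectiveStep α c β₂ g n i ≤ α / c := by
  induction n with
  | zero => simp [effectiveStep]
  | succ n ih => exact (effectiveStep_succ_le hβ₂ hα hc hgc n i).trans ih

theorem le_effectiveStep_succ (hβ₂ : 0 < β₂) (hα : 0 < α) (hc : 0 < c) {G : ℝ} (hG : 0 < G)
    (hg : ∀ t, 1 ≤ t → ‖g t‖ ≤ G)
    (hgc : ∀ j, c ≤ √(correctedSecondMoment β₂ g 1 j)) (n : ℕ) (i : Fin d) :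
    α / (G * √((n : ℝ) + 1)) ≤ effectiveStep α c β₂ g (n + 1) i := by
  simp only [effectiveStep, Nat.succ_ne_zero, if_false]
  have h1 := correctedSecondMoment_pos hβ₂ hc hgc n i
  have h2 : √(correctedSecondMoment β₂ g (n + 1) i) ≤ G := by
    rw [← Real.sqrt_sq hG.le]
    exact Real.sqrt_le_sqrt (correctedSecondMoment_le hβ₂ hg n i)
  have h3 : 0 < √(correctedSecondMoment β₂ g (n + 1) i) := Real.sqrt_pos.2 h1
  rw [div_div, mul_comm G]
  push_cast
  gcongr

/-- The decay in `n` comes from `α / √n` alone, as `v̂` is bounded below by `β₂ / (1 + β₂) * c²`.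
Being uniform in the coordinate, the bound combines with `‖m‖ ≤ G` without a factor `d`. -/
theorem sq_effectiveStep_succ_le (hβ₂ : 0 < β₂) (hc : 0 < c)
    (hgc : ∀ j, c ≤ √(correctedSecondMoment β₂ g 1 j)) (n : ℕ) (i : Fin d) :
    effectiveStep α c β₂ g (n + 1) i ^ 2 ≤
      (1 + β₂) / β₂ * α ^ 2 / c ^ 2 * ((n : ℝ) + 1)⁻¹ := by
  simp only [effectiveStep, Nat.succ_ne_zero, if_false]
  have h1 := correctedSecondMoment_pos hβ₂ hc hgc n i
  rw [div_pow, div_pow, Real.sq_sqrt (by positivity), Real.sq_sqrt h1.le]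
  have h2 : β₂ / (1 + β₂) * c ^ 2 ≤ correctedSecondMoment β₂ g (n + 1) i := by
    refine le_trans ?_ (le_correctedSecondMoment hβ₂ n i)
    have := hgc i
    rw [correctedSecondMoment_one hβ₂, Real.sqrt_sq_eq_abs] at this
    rw [← sq_abs (g 1 i)]
    gcongr
  calc _ ≤ α ^ 2 / ((n + 1 : ℕ) : ℝ) / (β₂ / (1 + β₂) * c ^ 2) := by gcongr
    _ = _ := by push_cast; field_simp

theorem norm_sq_displacement_succ_le (hβ₂ : 0 < β₂) (hc : 0 < c)
    (hgc : ∀ j, c ≤ √(correctedSecondMoment β₂ g 1 j)) {G : ℝ} (hG : 0 ≤ G) {β : ℕ → ℝ}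
    (hβ : ∀ t, 1 ≤ t → 0 ≤ β t ∧ β t ≤ 1) (hg : ∀ t, 1 ≤ t → ‖g t‖ ≤ G) (n : ℕ) :
    ‖displacement α c β₂ β g (n + 1)‖ ^ 2 ≤
      (1 + β₂) / β₂ * α ^ 2 / c ^ 2 * G ^ 2 * ((n : ℝ) + 1)⁻¹ := by
  have h1 : ‖firstMoment β g (n + 1)‖ ^ 2 ≤ G ^ 2 := by
    gcongr
    exact norm_firstMoment_le hG hβ hg _
  rw [EuclideanSpace.real_norm_sq_eq] at h1 ⊢
  simp only [displacement, mul_pow]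
  calc _ ≤ ∑ i, (1 + β₂) / β₂ * α ^ 2 / c ^ 2 * ((n : ℝ) + 1)⁻¹ *
        firstMoment β g (n + 1) i ^ 2 :=
        Finset.sum_le_sum fun i _ => mul_le_mul_of_nonneg_right
          (sq_effectiveStep_succ_le hβ₂ hc hgc n i) (sq_nonneg _)
    _ = (1 + β₂) / β₂ * α ^ 2 / c ^ 2 * ((n : ℝ) + 1)⁻¹ * ∑ i, firstMoment β g (n + 1) i ^ 2 := by
        rw [Finset.mul_sum]
    _ ≤ (1 + β₂) / β₂ * α ^ 2 / c ^ 2 * ((n : ℝ) + 1)⁻¹ * G ^ 2 := by gcongr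
    _ = _ := by ring

theorem displacement_zero (β : ℕ → ℝ) : displacement α c β₂ β g 0 = 0 := by
  ext i
  simp [displacement, firstMoment]

theorem sum_norm_sq_displacement_succ_le (hβ₂ : 0 < β₂) (hc : 0 < c)
    (hgc : ∀ j, c ≤ √(correctedSecondMoment β₂ g 1 j)) {G : ℝ} (hG : 0 ≤ G) {β : ℕ → ℝ}
    (hβ : ∀ t, 1 ≤ t → 0 ≤ β t ∧ β t ≤ 1) (hg : ∀ t, 1 ≤ t → ‖g t‖ ≤ G) (T : ℕ) :
    ∑ n ∈ Finset.range T, ‖displacement α c β₂ β g (n + 1)‖ ^ 2 ≤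
      (1 + β₂) / β₂ * α ^ 2 / c ^ 2 * G ^ 2 * (1 + Real.log T) := by
  calc _ ≤ ∑ n ∈ Finset.range T, (1 + β₂) / β₂ * α ^ 2 / c ^ 2 * G ^ 2 * ((n : ℝ) + 1)⁻¹ :=
        Finset.sum_le_sum fun n _ => norm_sq_displacement_succ_le hβ₂ hc hgc hG hβ hg n
    _ ≤ _ := by
        rw [← Finset.mul_sum]
        have := sum_range_inv_le_one_add_log T
        gcongr

/-- The momentum recursion pays for `Δ n`, the descent inequality for `Δ (n+1)`; both shifts obey
the same bound because `Δ 0 = 0`. -/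
theorem sum_norm_sq_displacement_le (hβ₂ : 0 < β₂) (hc : 0 < c)
    (hgc : ∀ j, c ≤ √(correctedSecondMoment β₂ g 1 j)) {G : ℝ} (hG : 0 ≤ G) {β : ℕ → ℝ}
    (hβ : ∀ t, 1 ≤ t → 0 ≤ β t ∧ β t ≤ 1) (hg : ∀ t, 1 ≤ t → ‖g t‖ ≤ G) (T : ℕ) :
    ∑ n ∈ Finset.range T, ‖displacement α c β₂ β g n‖ ^ 2 ≤
      (1 + β₂) / β₂ * α ^ 2 / c ^ 2 * G ^ 2 * (1 + Real.log T) := by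
  refine le_trans ?_ (sum_norm_sq_displacement_succ_le (α := α) hβ₂ hc hgc hG hβ hg T)
  have h1 := Finset.sum_range_succ' (fun n => ‖displacement α c β₂ β g n‖ ^ 2) T
  have h2 := Finset.sum_range_succ (fun n => ‖displacement α c β₂ β g n‖ ^ 2) T
  simp only [displacement_zero, norm_zero] at h1
  have h3 := sq_nonneg ‖displacement α c β₂ β g T‖
  linarith

theorem sum_effectiveStep_sub_le (hα : 0 < α) (hc : 0 < c) (T : ℕ) :
    ∑ n ∈ Finset.range T, ∑ i, (effectiveStep α c β₂ g n i - effectiveStep α c β₂ g (n + 1) i) ≤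
      d * α / c := by
  rw [Finset.sum_comm]
  calc _ ≤ ∑ _i : Fin d, α / c := by
        refine Finset.sum_le_sum fun i _ => ?_
        rw [Finset.sum_range_sub']
        have h := effectiveStep_nonneg (β₂ := β₂) (g := g) hα hc T i
        have h0 : effectiveStep α c β₂ g 0 i = α / c := by simp [effectiveStep]
        linarith
    _ = _ := by simp; ring

/-- The momentum recursion for `⟪∇f(x_n), displacement n⟫`. -/
theorem recurrence_inner_gradient_displacement (hβ₂ : 0 < β₂) (hα : 0 < α) (hc : 0 < c)
    (hgc : ∀ j, c ≤ √(correctedSecondMoment β₂ g 1 j)) {G : ℝ} (hG : 0 ≤ G) {β : ℕ → ℝ}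
    (hβ : ∀ t, 1 ≤ t → 0 ≤ β t ∧ β t ≤ 1) (hg : ∀ t, 1 ≤ t → ‖g t‖ ≤ G)
    {L : ℝ≥0} {F : Vec d → Vec d} (hF : LipschitzWith L F) {x : ℕ → Vec d}
    (hx : ∀ n, x (n + 1) = x n - displacement α c β₂ β g n) (hFx : ∀ t, 1 ≤ t → ‖F (x t)‖ ≤ G)
    (n : ℕ) :
    β (n + 1) * inner ℝ (F (x n)) (displacement α c β₂ β g n) +
      ((1 - β (n + 1)) * ∑ i, F (x (n + 1)) i * effectiveStep α c β₂ g n i * g (n + 1) i -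
        (G ^ 2 * ∑ i, (effectiveStep α c β₂ g n i - effectiveStep α c β₂ g (n + 1) i) +
          L * ‖displacement α c β₂ β g n‖ ^ 2)) ≤
    inner ℝ (F (x (n + 1))) (displacement α c β₂ β g (n + 1)) := by
  obtain ⟨hb0, hb1⟩ := hβ (n + 1) (by omega)
  set b := β (n + 1) with hb
  have hLip : inner ℝ (F (x n) - F (x (n + 1))) (displacement α c β₂ β g n) ≤
      L * ‖displacement α c β₂ β g n‖ ^ 2 := by
    refine (real_inner_le_norm _ _).trans ?_
    have h2 := hF.dist_le_mul (x n) (x (n + 1))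
    rw [dist_eq_norm, dist_eq_norm, hx n, sub_sub_cancel] at h2
    rw [hx n]
    calc _ ≤ (L * ‖displacement α c β₂ β g n‖) * ‖displacement α c β₂ β g n‖ := by gcongr
      _ = _ := by ring
  have hLip' := mul_le_mul_of_nonneg_left hLip hb0
  have hLb : b * (L * ‖displacement α c β₂ β g n‖ ^ 2) ≤ L * ‖displacement α c β₂ β g n‖ ^ 2 :=
    mul_le_of_le_one_left (by positivity) hb1
  have hsum : b * inner ℝ (F (x (n + 1))) (displacement α c β₂ β g n) +
      ((1 - b) * ∑ i, F (x (n + 1)) i * effectiveStep α c β₂ g n i * g (n + 1) i -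
        G ^ 2 * ∑ i, (effectiveStep α c β₂ g n i - effectiveStep α c β₂ g (n + 1) i)) ≤
      inner ℝ (F (x (n + 1))) (displacement α c β₂ β g (n + 1)) := by
    simp only [PiLp.inner_apply, RCLike.inner_apply, conj_trivial, Finset.mul_sum,
      ← Finset.sum_add_distrib, ← Finset.sum_sub_distrib]
    refine Finset.sum_le_sum fun i _ => ?_
    simp only [displacement]
    have hm : firstMoment β g (n + 1) i = b * firstMoment β g n i + (1 - b) * g (n + 1) i := by
      simp [firstMoment, hb]
    have hD := effectiveStep_succ_le hβ₂ hα hc hgc n i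
    have hFi : |F (x (n + 1)) i| ≤ G :=
      (PiLp.norm_apply_le (F (x (n + 1))) i).trans (hFx _ (by omega))
    have hmi : |firstMoment β g (n + 1) i| ≤ G :=
      (PiLp.norm_apply_le (firstMoment β g (n + 1)) i).trans (norm_firstMoment_le hG hβ hg _)
    -- Replacing `D (n+1)` by the larger `D n` costs at most `G² * (D n - D (n+1))`, whose sum
    -- telescopes.
    have hprod : F (x (n + 1)) i * firstMoment β g (n + 1) i ≤ G ^ 2 := by
      refine (le_abs_self _).trans ?_
      rw [abs_mul, sq]
      exact mul_le_mul hFi hmi (abs_nonneg _) hG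
    have h := mul_le_mul_of_nonneg_right hprod (sub_nonneg.2 hD)
    rw [hm] at h ⊢
    linarith
  rw [inner_sub_left] at hLip'
  linarith

/-- Pathwise estimate: a weighted sum of the inner products of the true gradient with the noisy
gradient, scaled by the preceding effective step, is bounded. -/
theorem sum_weights_mul_inner_le (hβ₂ : 0 < β₂) (hα : 0 < α) (hc : 0 < c)
    {L : ℝ≥0} {f : Vec d → ℝ} (hf : Differentiable ℝ f) (hL : LipschitzWith L (∇ f))
    (hbdd : BddBelow (Set.range f)) {G : ℝ} (hG : 0 ≤ G) {β₁ : ℝ} (hβ₁ : β₁ < 1) {β : ℕ → ℝ}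
    (hβ : ∀ t, 1 ≤ t → 0 ≤ β t ∧ β t ≤ 1) (T : ℕ) {u : ℕ → ℝ} {k : ℝ}
    (hu : ∀ n, 1 ≤ u n ∧ u n ≤ 1 / (1 - β₁))
    (huq : ∀ A q : ℕ → ℝ, (∀ n, β (n + 1) * A n + q n ≤ A (n + 1)) →
        k * A 0 + ∑ n ∈ Finset.range T, u n * q n ≤ ∑ n ∈ Finset.range T, A (n + 1))
    (hgc : ∀ j, c ≤ √(correctedSecondMoment β₂ g 1 j)) (hg : ∀ t, 1 ≤ t → ‖g t‖ ≤ G)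
    {x₁ : Vec d} {x : ℕ → Vec d} (hx₁ : x 1 = x₁)
    (hx : ∀ n, x (n + 1) = x n - displacement α c β₂ β g n)
    (hFx : ∀ t, 1 ≤ t → ‖∇ f (x t)‖ ≤ G) :
    ∑ n ∈ Finset.range T, u n * (1 - β (n + 1)) *
        ∑ i, ∇ f (x (n + 1)) i * effectiveStep α c β₂ g n i * g (n + 1) i ≤
      f x₁ - (⨅ y, f y) + 1 / (1 - β₁) * (G ^ 2 * (d * α / c)) +
      (L + L / (1 - β₁)) * ((1 + β₂) / β₂ * α ^ 2 / c ^ 2 * G ^ 2 * (1 + Real.log T)) := by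
  have hw : 0 < 1 - β₁ := by linarith
  have h1 := huq (fun n => inner ℝ (∇ f (x n)) (displacement α c β₂ β g n)) _
    (recurrence_inner_gradient_displacement hβ₂ hα hc hgc hG hβ hg hL hx hFx)
  -- The boundary term `k * A 0` vanishes, so `k` plays no further role.
  simp only [displacement_zero, inner_zero_right, mul_zero, zero_add] at h1
  have hdesc : ∑ n ∈ Finset.range T,
      inner ℝ (∇ f (x (n + 1))) (displacement α c β₂ β g (n + 1)) ≤
      f x₁ - (⨅ y, f y) + L * ∑ n ∈ Finset.range T, ‖displacement α c β₂ β g (n + 1)‖ ^ 2 := by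
    have hstep : ∀ n ∈ Finset.range T,
        inner ℝ (∇ f (x (n + 1))) (displacement α c β₂ β g (n + 1)) ≤
        (f (x (n + 1)) - f (x (n + 1 + 1))) + L * ‖displacement α c β₂ β g (n + 1)‖ ^ 2 := by
      intro n _
      have h := le_add_inner_gradient_add hf hL (x (n + 1)) (x (n + 1 + 1))
      rw [hx (n + 1), sub_sub_cancel_left, inner_neg_right, norm_neg, ← hx (n + 1)] at h
      linarith
    have h := Finset.sum_le_sum hstep
    rw [Finset.sum_add_distrib, ← Finset.mul_sum,
      Finset.sum_range_sub' (fun n => f (x (n + 1)))] at h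
    have h' := ciInf_le hbdd (x (T + 1))
    rw [zero_add, hx₁] at h
    linarith
  have herr : ∑ n ∈ Finset.range T, u n *
      (G ^ 2 * ∑ i, (effectiveStep α c β₂ g n i - effectiveStep α c β₂ g (n + 1) i) +
          L * ‖displacement α c β₂ β g n‖ ^ 2) ≤
      1 / (1 - β₁) * (G ^ 2 * ∑ n ∈ Finset.range T,
        ∑ i, (effectiveStep α c β₂ g n i - effectiveStep α c β₂ g (n + 1) i) +
          L * ∑ n ∈ Finset.range T, ‖displacement α c β₂ β g n‖ ^ 2) := by
    rw [Finset.mul_sum, Finset.mul_sum, ← Finset.sum_add_distrib, Finset.mul_sum]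
    refine Finset.sum_le_sum fun n _ => mul_le_mul_of_nonneg_right (hu n).2 ?_
    have := Finset.sum_nonneg fun i (_ : i ∈ Finset.univ) =>
      sub_nonneg.2 (effectiveStep_succ_le hβ₂ hα hc hgc n i)
    positivity
  have hs := sum_effectiveStep_sub_le (β₂ := β₂) (g := g) hα hc T
  have hd0 := sum_norm_sq_displacement_le (α := α) hβ₂ hc hgc hG hβ hg T
  have hd1 := sum_norm_sq_displacement_succ_le (α := α) hβ₂ hc hgc hG hβ hg T
  have hsplit : ∑ n ∈ Finset.range T, u n * ((1 - β (n + 1)) *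
        ∑ i, ∇ f (x (n + 1)) i * effectiveStep α c β₂ g n i * g (n + 1) i -
        (G ^ 2 * ∑ i, (effectiveStep α c β₂ g n i - effectiveStep α c β₂ g (n + 1) i) +
          L * ‖displacement α c β₂ β g n‖ ^ 2)) =
      ∑ n ∈ Finset.range T, u n * (1 - β (n + 1)) *
        ∑ i, ∇ f (x (n + 1)) i * effectiveStep α c β₂ g n i * g (n + 1) i -
      ∑ n ∈ Finset.range T, u n *
      (G ^ 2 * ∑ i, (effectiveStep α c β₂ g n i - effectiveStep α c β₂ g (n + 1) i) +
          L * ‖displacement α c β₂ β g n‖ ^ 2) := by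
    rw [← Finset.sum_sub_distrib]
    exact Finset.sum_congr rfl fun n _ => by ring
  rw [hsplit] at h1
  have e1 := mul_le_mul_of_nonneg_left hd1 L.2
  have e2 : 1 / (1 - β₁) * (G ^ 2 * ∑ n ∈ Finset.range T,
        ∑ i, (effectiveStep α c β₂ g n i - effectiveStep α c β₂ g (n + 1) i) +
          L * ∑ n ∈ Finset.range T, ‖displacement α c β₂ β g n‖ ^ 2) ≤
      1 / (1 - β₁) * (G ^ 2 * (d * α / c) +
        L * ((1 + β₂) / β₂ * α ^ 2 / c ^ 2 * G ^ 2 * (1 + Real.log T))) := by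
    gcongr
  have e3 : (L + L / (1 - β₁)) * ((1 + β₂) / β₂ * α ^ 2 / c ^ 2 * G ^ 2 * (1 + Real.log T)) =
      L * ((1 + β₂) / β₂ * α ^ 2 / c ^ 2 * G ^ 2 * (1 + Real.log T)) +
      1 / (1 - β₁) * (L * ((1 + β₂) / β₂ * α ^ 2 / c ^ 2 * G ^ 2 * (1 + Real.log T))) := by
    ring
  rw [e3]
  simp only [NNReal.val_eq_coe] at e1
  linarith

end Deterministic

end AdaX

namespace AdaX

/-! ### Adaptedness of the algorithm to the gradients and to the noise -/

section Measurability

variable {d : ℕ} {Ω : Type*} [MeasurableSpace Ω] {g : ℕ → Ω → Vec d}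

theorem measurable_firstMoment (β : ℕ → ℝ) (n : ℕ)
    (hg : ∀ s, 1 ≤ s → s ≤ n → Measurable (g s)) :
    Measurable fun ω => firstMoment β (fun s => g s ω) n := by
  induction n with
  | zero => exact measurable_const
  | succ n ih =>
    simp only [firstMoment]
    have h1 := ih fun s h1 h2 => hg s h1 (by omega)
    have h2 := hg (n + 1) (by omega) le_rfl
    fun_prop

theorem measurable_secondMoment_apply (β₂ : ℝ) (n : ℕ)
    (hg : ∀ s, 1 ≤ s → s ≤ n → Measurable (g s)) (i : Fin d) :
    Measurable fun ω => secondMoment β₂ (fun s => g s ω) n i := by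
  induction n with
  | zero => exact measurable_const
  | succ n ih =>
    simp only [secondMoment]
    have h1 := ih fun s h1 h2 => hg s h1 (by omega)
    have h2 := hg (n + 1) (by omega) le_rfl
    have h3 : Measurable fun ω => g (n + 1) ω i := by fun_prop
    exact (h1.const_mul _).add ((h3.pow_const 2).const_mul _)

theorem measurable_effectiveStep (α c β₂ : ℝ) (n : ℕ)
    (hg : ∀ s, 1 ≤ s → s ≤ n → Measurable (g s)) (i : Fin d) :
    Measurable fun ω => effectiveStep α c β₂ (fun s => g s ω) n i := by
  unfold effectiveStep
  split_ifs
  · exact measurable_const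
  · simp only [correctedSecondMoment]
    have h := measurable_secondMoment_apply β₂ n hg i
    exact ((h.div_const _).sqrt).const_div _

theorem measurable_randomIterate_succ (α β₂ : ℝ) (β : ℕ → ℝ) (x₁ : Vec d) (n : ℕ)
    (hg : ∀ s, 1 ≤ s → s ≤ n → Measurable (g s)) :
    Measurable (randomIterate α β β₂ x₁ g (n + 1)) := by
  unfold randomIterate
  induction n with
  | zero => exact measurable_const
  | succ n ih =>
    -- The value `1` for `c` is arbitrary: `c` enters only the effective step at time `0`.
    simp only [iterate_succ α 1 β₂ β x₁ _ (n + 1), displacement]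
    have h1 := ih fun s h1 h2 => hg s h1 (by omega)
    refine h1.sub ((WithLp.measurable_toLp 2 _).comp (measurable_pi_lambda _ fun i => ?_))
    have h2 := measurable_effectiveStep α 1 β₂ (n + 1) hg i
    have h3 := measurable_firstMoment β (n + 1) hg
    have h4 : Measurable fun ω => firstMoment β (fun s => g s ω) (n + 1) i := by fun_prop
    exact h2.mul h4

/-- The gradients received up to time `n` are determined by the noise up to time `n`. -/
theorem measurable_of_measurable_noise (α β₂ : ℝ) (β : ℕ → ℝ) (x₁ : Vec d)
    {F : Vec d → Vec d} (hF : Measurable F) {η : ℕ → Ω → Vec d} (n : ℕ)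
    (hη : ∀ s, 1 ≤ s → s ≤ n → Measurable (η s))
    (hg : ∀ s, 1 ≤ s → ∀ ω, g s ω = F (randomIterate α β β₂ x₁ g s ω) + η s ω) :
    ∀ s, 1 ≤ s → s ≤ n → Measurable (g s) := by
  intro s
  induction s using Nat.strong_induction_on with
  | _ s ih =>
    intro h1 h2
    obtain ⟨s, rfl⟩ : ∃ k, s = k + 1 := ⟨s - 1, by omega⟩
    have hx := measurable_randomIterate_succ α β₂ β x₁ s
      fun r hr hr' => ih r (by omega) hr (by omega)
    rw [funext (hg (s + 1) h1)]
    exact (hF.comp hx).add (hη _ h1 h2)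

end Measurability

/-! ### Orthogonality of the noise to the past -/

section Expectation

variable {d : ℕ} {Ω : Type*} [mΩ : MeasurableSpace Ω] {μ : Measure Ω}

/-- A bounded function of the past noise is uncorrelated with the next centred noise vector. -/
theorem integral_mul_apply_eq_zero {ξ : ℕ → Ω → Vec d} (hξ : ∀ n, Measurable (ξ n))
    (hindep : iIndepFun ξ μ) {n : ℕ} (hint : Integrable (ξ n) μ) (hmean : ∫ ω, ξ n ω ∂μ = 0)
    {X : Ω → ℝ} (hX : Measurable[⨆ s ∈ Set.Iio n, MeasurableSpace.comap (ξ s) inferInstance] X)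
    (i : Fin d) : ∫ ω, X ω * ξ n ω i ∂μ = 0 := by
  have hle : ∀ s, MeasurableSpace.comap (ξ s) inferInstance ≤ mΩ := fun s => (hξ s).comap_le
  -- The index sets `{s | s < n}` and `{n}` are disjoint, so the joint σ-algebra of the past noise
  -- is independent of `ξ n`.
  have hI := indep_iSup_of_disjoint hle hindep.iIndep
    (S := Set.Iio n) (T := {n}) (by simp)
  simp only [Set.mem_singleton_iff, iSup_iSup_eq_left] at hI
  have hX' : Measurable X := hX.mono (iSup₂_le fun s _ => hle s) le_rfl
  have happ : Measurable fun v : Vec d => v i := by fun_prop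
  have hXξ : IndepFun X (fun ω => ξ n ω i) μ := by
    rw [IndepFun_iff_Indep]
    refine indep_of_indep_of_le_left (indep_of_indep_of_le_right hI ?_) hX.comap_le
    have : (fun ω => ξ n ω i) = (fun v : Vec d => v i) ∘ ξ n := rfl
    rw [this, ← MeasurableSpace.comap_comp]
    exact MeasurableSpace.comap_mono happ.comap_le
  rw [hXξ.integral_fun_mul_eq_mul_integral hX'.aestronglyMeasurable
    (happ.comp (hξ n)).aestronglyMeasurable]
  have h := (EuclideanSpace.proj (𝕜 := ℝ) i : Vec d →L[ℝ] ℝ).integral_comp_comm hint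
  rw [hmean] at h
  have h' : ∫ ω, ξ n ω i ∂μ = 0 := by simpa using h
  rw [h', mul_zero]

end Expectation

end AdaX

namespace AdaX

/-! ### Passage to expectations and the convergence rate -/

section ExpectedDescent

variable {d : ℕ} {Ω : Type*} [MeasurableSpace Ω] {μ : Measure Ω}

theorem bddBelow_range_integral_norm_sq (F : Vec d → Vec d) (x : ℕ → Ω → Vec d) (T : ℕ) :
    BddBelow (Set.range fun t : Finset.Icc 1 T => ∫ ω, ‖F (x t ω)‖ ^ 2 ∂μ) :=
  ⟨0, by rintro _ ⟨t, rfl⟩; positivity⟩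

theorem minExpectedSqGrad_nonneg (f : Vec d → ℝ) (x : ℕ → Ω → Vec d) (T : ℕ) :
    0 ≤ minExpectedSqGrad μ f x T :=
  Real.iInf_nonneg fun _ => by positivity

variable [IsProbabilityMeasure μ]

/-- The scaled inner product `∑ᵢ Fᵢ(x_{n+1}) · effectiveStep n i · (g_{n+1})ᵢ` of a field `F` at the
iterate with the next gradient received. -/
noncomputable def scaledInner (α c β₂ : ℝ) (F : Vec d → Vec d) (x g : ℕ → Ω → Vec d) (n : ℕ)
    (ω : Ω) : ℝ :=
  ∑ i, F (x (n + 1) ω) i * effectiveStep α c β₂ (fun s => g s ω) n i * g (n + 1) ω i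

theorem integrable_norm_sq_comp {F : Vec d → Vec d} (hF : Measurable F) {x : Ω → Vec d}
    (hx : Measurable x) {G : ℝ} (h : ∀ᵐ ω ∂μ, ‖F (x ω)‖ ≤ G) :
    Integrable (fun ω => ‖F (x ω)‖ ^ 2) μ := by
  refine Integrable.of_bound ((hF.comp hx).norm.pow_const 2).aestronglyMeasurable (G ^ 2) ?_
  filter_upwards [h] with ω hω
  rw [Real.norm_of_nonneg (by positivity)]
  gcongr

theorem integrable_coordinate_mul {α c β₂ G : ℝ} (hα : 0 < α) (hc : 0 < c) (hβ₂ : 0 < β₂)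
    (hG : 0 ≤ G) {F : Vec d → Vec d} (hF : Measurable F) {x g : ℕ → Ω → Vec d} (n : ℕ)
    (hg : ∀ t, 1 ≤ t → Measurable (g t)) (hx : Measurable (x (n + 1)))
    (hFx : ∀ᵐ ω ∂μ, ‖F (x (n + 1) ω)‖ ≤ G)
    (hgc : ∀ᵐ ω ∂μ, ∀ j, c ≤ √(correctedSecondMoment β₂ (fun s => g s ω) 1 j))
    {y : Ω → Vec d} (hy : Measurable y) {B : ℝ} (hyB : ∀ᵐ ω ∂μ, ‖y ω‖ ≤ B) (i : Fin d) :
    Integrable (fun ω => F (x (n + 1) ω) i * effectiveStep α c β₂ (fun s => g s ω) n i * y ω i)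
      μ := by
  have happ : Measurable fun v : Vec d => v i := by fun_prop
  have hD := measurable_effectiveStep α c β₂ n (fun s h _ => hg s h) i
  refine Integrable.of_bound (((happ.comp (hF.comp hx)).mul hD).mul
    (happ.comp hy)).aestronglyMeasurable (G * (α / c) * B) ?_
  filter_upwards [hFx, hgc, hyB] with ω h1 h2 h3
  have h4 := (PiLp.norm_apply_le (F (x (n + 1) ω)) i).trans h1
  have h5 := (PiLp.norm_apply_le (y ω) i).trans h3
  have h6 := effectiveStep_le hβ₂ hα hc h2 n i
  have h7 := effectiveStep_nonneg (β₂ := β₂) (g := fun s => g s ω) hα hc n i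
  rw [norm_mul, norm_mul, Real.norm_of_nonneg h7]
  gcongr

/-- The noise is unbiased given the past, and the effective step is at least `α / (G √(n + 1))`. -/
theorem le_integral_scaledInner {α c β₂ G : ℝ} (hα : 0 < α) (hc : 0 < c) (hβ₂ : 0 < β₂)
    (hG : 0 < G) {F : Vec d → Vec d} (hF : Measurable F) {β : ℕ → ℝ} {x₁ : Vec d}
    {g η : ℕ → Ω → Vec d} (hg : ∀ t, 1 ≤ t → Measurable (g t))
    (hbound : ∀ t, 1 ≤ t →
      ∀ᵐ ω ∂μ, ‖F (randomIterate α β β₂ x₁ g t ω)‖ ≤ G ∧ ‖g t ω‖ ≤ G)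
    (hη : ∀ t, 1 ≤ t → ∀ ω, g t ω = F (randomIterate α β β₂ x₁ g t ω) + η t ω)
    (hmean : ∀ t, 1 ≤ t → ∫ ω, η t ω ∂μ = 0)
    (hindep : iIndepFun (fun t : ℕ => η (t + 1)) μ)
    (hgc : ∀ᵐ ω ∂μ, ∀ j, c ≤ √(correctedSecondMoment β₂ (fun s => g s ω) 1 j)) (n : ℕ) :
    α / (G * √((n : ℝ) + 1)) * ∫ ω, ‖F (randomIterate α β β₂ x₁ g (n + 1) ω)‖ ^ 2 ∂μ ≤
      ∫ ω, scaledInner α c β₂ F (randomIterate α β β₂ x₁ g) g n ω ∂μ := by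
  set x := randomIterate α β β₂ x₁ g with hx_def
  have hx : ∀ n, Measurable (x (n + 1)) := fun n =>
    measurable_randomIterate_succ α β₂ β x₁ n fun s h _ => hg s h
  have hη_eq : ∀ n, η (n + 1) = fun ω => g (n + 1) ω - F (x (n + 1) ω) := fun n =>
    funext fun ω => by rw [hη (n + 1) (by omega) ω, add_sub_cancel_left]
  have hη_meas : ∀ n, Measurable (η (n + 1)) := fun n => by
    rw [hη_eq]
    exact (hg _ (by omega)).sub (hF.comp (hx n))
  have hFx := fun n => (hbound (n + 1) (by omega)).mono fun ω h => h.1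
  have hη_bound : ∀ᵐ ω ∂μ, ‖η (n + 1) ω‖ ≤ G + G := by
    filter_upwards [hbound (n + 1) (by omega)] with ω h
    rw [hη_eq]
    exact (norm_sub_le _ _).trans (add_le_add h.2 h.1)
  have hη_int : Integrable (η (n + 1)) μ :=
    Integrable.of_bound (hη_meas n).aestronglyMeasurable _ hη_bound
  have hzero : ∀ i, ∫ ω, F (x (n + 1) ω) i * effectiveStep α c β₂ (fun s => g s ω) n i *
      η (n + 1) ω i ∂μ = 0 := by
    intro i
    refine integral_mul_apply_eq_zero (ξ := fun t => η (t + 1)) hη_meas hindep hη_int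
      (hmean _ (by omega)) ?_ i
    -- The σ-algebra of `η 1, …, η n`. Both `x (n+1)` and `D n` are measurable for it, whereas `D
    -- (n+1)` would involve `g (n+1)` and hence `η (n+1)`.
    set m : MeasurableSpace Ω :=
      ⨆ s ∈ Set.Iio n, MeasurableSpace.comap (η (s + 1)) inferInstance with hm
    have hgm : ∀ s, 1 ≤ s → s ≤ n → Measurable[m] (g s) := by
      refine @measurable_of_measurable_noise d Ω m g α β₂ β x₁ F hF η n ?_ hη
      intro s h1 h2
      obtain ⟨s, rfl⟩ : ∃ k, s = k + 1 := ⟨s - 1, by omega⟩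
      exact (comap_measurable (η (s + 1))).mono
        (le_iSup₂_of_le s (Set.mem_Iio.2 (by omega)) le_rfl) le_rfl
    have hxm := @measurable_randomIterate_succ d Ω m g α β₂ β x₁ n hgm
    have hDm := @measurable_effectiveStep d Ω m g α c β₂ n hgm i
    have happ : Measurable fun v : Vec d => v i := by fun_prop
    exact (happ.comp (hF.comp hxm)).mul hDm
  have hint1 := fun i => integrable_coordinate_mul (μ := μ) hα hc hβ₂ hG.le hF n hg (hx n) (hFx n)
    hgc (y := fun ω => F (x (n + 1) ω)) (hF.comp (hx n)) (hFx n) i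
  have hint2 := fun i => integrable_coordinate_mul (μ := μ) hα hc hβ₂ hG.le hF n hg (hx n) (hFx n)
    hgc (hη_meas n) hη_bound i
  have hsplit : ∫ ω, scaledInner α c β₂ F x g n ω ∂μ =
      ∫ ω, ∑ i, F (x (n + 1) ω) i * effectiveStep α c β₂ (fun s => g s ω) n i *
        F (x (n + 1) ω) i ∂μ := by
    have : scaledInner α c β₂ F x g n = fun ω =>
        ∑ i, F (x (n + 1) ω) i * effectiveStep α c β₂ (fun s => g s ω) n i * F (x (n + 1) ω) i +
        ∑ i, F (x (n + 1) ω) i * effectiveStep α c β₂ (fun s => g s ω) n i * η (n + 1) ω i := by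
      funext ω
      rw [scaledInner, ← Finset.sum_add_distrib]
      refine Finset.sum_congr rfl fun i _ => ?_
      rw [← mul_add]
      congr 1
      rw [hη (n + 1) (by omega) ω]
      rfl
    simp only [this]
    rw [integral_add (integrable_finsetSum _ fun i _ => hint1 i)
      (integrable_finsetSum _ fun i _ => hint2 i), integral_finsetSum _ fun i _ => hint2 i,
      Finset.sum_eq_zero fun i _ => hzero i, add_zero]
  rw [hsplit, ← integral_const_mul]
  refine integral_mono_ae ((integrable_norm_sq_comp hF (hx n) (hFx n)).const_mul _)
    (integrable_finsetSum _ fun i _ => hint1 i) ?_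
  have hall : ∀ᵐ ω ∂μ, ∀ t, 1 ≤ t → ‖g t ω‖ ≤ G :=
    ae_all_iff.2 fun t => by
      by_cases ht : 1 ≤ t
      · filter_upwards [hbound t ht] with ω h _ using h.2
      · exact Eventually.of_forall fun ω h => absurd h ht
  filter_upwards [hall, hgc] with ω h1 h2
  simp only [EuclideanSpace.real_norm_sq_eq, Finset.mul_sum]
  refine Finset.sum_le_sum fun i _ => ?_
  -- Going through `D (n+1) ≤ D n` covers `n = 0` too, where `D 0 = α / c` is only a convention.
  have h := (le_effectiveStep_succ hβ₂ hα hc hG h1 h2 n i).trans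
    (effectiveStep_succ_le hβ₂ hα hc h2 n i)
  calc _ ≤ effectiveStep α c β₂ (fun s => g s ω) n i * F (x (n + 1) ω) i ^ 2 := by gcongr
    _ = _ := by ring

/-- The convergence bound, multiplied through by `√T`. -/
theorem mul_minExpectedSqGrad_le {α c β₁ β₂ G : ℝ} (hα : 0 < α) (hc : 0 < c) (hβ₂ : 0 < β₂)
    (hG : 0 < G) (hβ₁ : 0 ≤ β₁) (hβ₁' : β₁ < 1) {L : ℝ≥0} {f : Vec d → ℝ}
    (hf : Differentiable ℝ f) (hL : LipschitzWith L (∇ f)) (hbdd : BddBelow (Set.range f))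
    {β : ℕ → ℝ} (hβ : ∀ t, 1 ≤ t → 0 ≤ β t ∧ β t ≤ β₁) {x₁ : Vec d}
    {g η : ℕ → Ω → Vec d} (hg : ∀ t, 1 ≤ t → Measurable (g t))
    (hbound : ∀ t, 1 ≤ t →
      ∀ᵐ ω ∂μ, ‖∇ f (randomIterate α β β₂ x₁ g t ω)‖ ≤ G ∧ ‖g t ω‖ ≤ G)
    (hη : ∀ t, 1 ≤ t → ∀ ω, g t ω = ∇ f (randomIterate α β β₂ x₁ g t ω) + η t ω)
    (hmean : ∀ t, 1 ≤ t → ∫ ω, η t ω ∂μ = 0)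
    (hindep : iIndepFun (fun t : ℕ => η (t + 1)) μ)
    (hgc : ∀ᵐ ω ∂μ, ∀ j, c ≤ √(correctedSecondMoment β₂ (fun s => g s ω) 1 j))
    {T : ℕ} (hT : 1 ≤ T) :
    (1 - β₁) * (α * √(T : ℝ) / G) * minExpectedSqGrad μ f (randomIterate α β β₂ x₁ g) T ≤
      f x₁ - (⨅ y, f y) + 1 / (1 - β₁) * (G ^ 2 * (d * α / c)) +
      (L + L / (1 - β₁)) * ((1 + β₂) / β₂ * α ^ 2 / c ^ 2 * G ^ 2 * (1 + Real.log T)) := by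
  set R := f x₁ - (⨅ y, f y) + 1 / (1 - β₁) * (G ^ 2 * (d * α / c)) +
      (L + L / (1 - β₁)) * ((1 + β₂) / β₂ * α ^ 2 / c ^ 2 * G ^ 2 * (1 + Real.log T)) with hR
  set x := randomIterate α β β₂ x₁ g with hx_def
  set M := minExpectedSqGrad μ f x T with hM
  have hF : Measurable (∇ f) := hL.continuous.measurable
  have hβ' : ∀ t, 1 ≤ t → 0 ≤ β t ∧ β t ≤ 1 := fun t ht =>
    ⟨(hβ t ht).1, (hβ t ht).2.trans hβ₁'.le⟩
  obtain ⟨u, k, hu, -, huq⟩ := exists_weights_of_recurrence hβ₁ hβ₁' T (fun n => β (n + 1))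
    fun n => hβ (n + 1) (by omega)
  have hall : ∀ᵐ ω ∂μ, ∀ t, 1 ≤ t → ‖∇ f (x t ω)‖ ≤ G ∧ ‖g t ω‖ ≤ G :=
    ae_all_iff.2 fun t => by
      by_cases ht : 1 ≤ t
      · filter_upwards [hbound t ht] with ω h _ using h
      · exact Eventually.of_forall fun ω h => absurd h ht
  have hpath : ∀ᵐ ω ∂μ, ∑ n ∈ Finset.range T, u n * (1 - β (n + 1)) *
      scaledInner α c β₂ (∇ f) x g n ω ≤ R := by
    filter_upwards [hall, hgc] with ω h1 h2
    exact sum_weights_mul_inner_le hβ₂ hα hc hf hL hbdd hG.le hβ₁' hβ' T hu huq h2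
      (fun t ht => (h1 t ht).2) (x := fun t => x t ω) rfl
      (fun n => iterate_succ α c β₂ β x₁ (fun s => g s ω) n) (fun t ht => (h1 t ht).1)
  have hx : ∀ n, Measurable (x (n + 1)) := fun n =>
    measurable_randomIterate_succ α β₂ β x₁ n fun s h _ => hg s h
  have hint : ∀ n, Integrable (scaledInner α c β₂ (∇ f) x g n) μ := fun n => by
    have h1 := hbound (n + 1) (by omega)
    exact integrable_finsetSum _ fun i _ => integrable_coordinate_mul hα hc hβ₂ hG.le hF n hg
      (hx n) (h1.mono fun ω h => h.1) hgc (hg (n + 1) (by omega)) (h1.mono fun ω h => h.2) i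
  have hexp : ∑ n ∈ Finset.range T, u n * (1 - β (n + 1)) *
      ∫ ω, scaledInner α c β₂ (∇ f) x g n ω ∂μ ≤ R := by
    have h := integral_mono_ae
      (integrable_finsetSum (Finset.range T) fun n _ => (hint n).const_mul (u n * (1 - β (n + 1))))
      (integrable_const R) hpath
    rw [integral_finsetSum _ fun n _ => (hint n).const_mul _] at h
    simpa [integral_const_mul] using h
  have hM0 : 0 ≤ M := minExpectedSqGrad_nonneg f x T
  have hT0 : (0 : ℝ) < T := by exact_mod_cast hT
  -- A lower bound independent of `n`, using `n + 1 ≤ T` and `u n ≥ 1`; adding `T` copies turns `1 /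
  -- √T` into `√T`.
  have hterm : ∀ n ∈ Finset.range T, (1 - β₁) * (α / (G * √(T : ℝ)) * M) ≤
      u n * (1 - β (n + 1)) * ∫ ω, scaledInner α c β₂ (∇ f) x g n ω ∂μ := by
    intro n hn
    rw [Finset.mem_range] at hn
    have h1 := le_integral_scaledInner hα hc hβ₂ hG hF hg hbound hη hmean hindep hgc n
    have h2 : M ≤ ∫ ω, ‖∇ f (x (n + 1) ω)‖ ^ 2 ∂μ :=
      ciInf_le (bddBelow_range_integral_norm_sq (∇ f) x T)
        ⟨n + 1, Finset.mem_Icc.2 ⟨by omega, by omega⟩⟩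
    have h3 : α / (G * √(T : ℝ)) * M ≤ ∫ ω, scaledInner α c β₂ (∇ f) x g n ω ∂μ := by
      refine le_trans ?_ h1
      have : (n : ℝ) + 1 ≤ T := by exact_mod_cast hn
      gcongr
    have h4 : 1 - β₁ ≤ u n * (1 - β (n + 1)) := by
      have h5 := hβ (n + 1) (by omega)
      calc 1 - β₁ ≤ 1 * (1 - β (n + 1)) := by linarith [h5.2]
        _ ≤ _ := mul_le_mul_of_nonneg_right (hu n).1 (by linarith [h5.2])
    exact mul_le_mul h4 h3 (by positivity) ((sub_pos.2 hβ₁').le.trans h4)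
  have hsum := (Finset.sum_le_sum hterm).trans hexp
  rw [Finset.sum_const, Finset.card_range, nsmul_eq_mul] at hsum
  refine le_trans (le_of_eq ?_) hsum
  have hs : √(T : ℝ) ≠ 0 := (Real.sqrt_pos.2 hT0).ne'
  field_simp
  rw [Real.sq_sqrt hT0.le]
  ring

end ExpectedDescent

/-- Once `log T ≥ 1`, the constant `A` is absorbed into `|A| * log T`. -/
theorem isBigO_log_div_sqrt {h : ℕ → ℝ} {A B : ℝ} (h0 : ∀ T, 0 ≤ h T)
    (hh : ∀ T : ℕ, 1 ≤ T → h T ≤ (A + B * Real.log T) / √(T : ℝ)) :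
    h =O[atTop] fun T : ℕ => Real.log T / √(T : ℝ) := by
  refine IsBigO.of_bound (|A| + B) ?_
  have hlog : Tendsto (fun T : ℕ => Real.log T) atTop atTop :=
    Real.tendsto_log_atTop.comp tendsto_natCast_atTop_atTop
  filter_upwards [hlog.eventually_ge_atTop 1, eventually_ge_atTop 1] with T h1 h2
  rw [Real.norm_of_nonneg (h0 T), Real.norm_of_nonneg (by positivity), ← mul_div_assoc]
  refine (hh T h2).trans ?_
  gcongr
  nlinarith [le_abs_self A, abs_nonneg A]

end AdaX

theorem theorem4
    (L : ℝ≥0) (Ginf β₁ β₂ : ℝ) (hGinf : 0 < Ginf) (hβ₁ : 0 ≤ β₁) (hβ₁' : β₁ < 1) (hβ₂ : 0 < β₂) :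
    -- `C₁, C₂, C₃` depend only on `L`, `Ginf`, `β₁`, `β₂`
    ∃ C₁ C₂ C₃ : ℝ,
    ∀ (d : ℕ) (f : AdaX.Vec d → ℝ) (x₁ : AdaX.Vec d) (α c : ℝ), 0 < α → 0 < c →
      -- smoothness of `f`, and `f` is bounded below
      Differentiable ℝ f → LipschitzWith L (∇ f) → BddBelow (Set.range f) →
    -- `C₄` depends in addition on `d`, `f`, `x₁`, `α`, `c`, but neither on the run nor on `T`
    ∃ C₄ : ℝ,
    ∀ (β₁seq : ℕ → ℝ), (∀ t, 1 ≤ t → 0 ≤ β₁seq t ∧ β₁seq t ≤ β₁) →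
    ∀ (Ω : Type*) [MeasurableSpace Ω] (μ : Measure Ω) [IsProbabilityMeasure μ]
      (g x η : ℕ → Ω → AdaX.Vec d),
      (∀ t, 1 ≤ t → Measurable (g t)) →
      -- the iterates are those of AdaX run on the noisy gradients `g`
      x = AdaX.randomIterate α β₁seq β₂ x₁ g →
      -- bounded noisy and true gradients
      (∀ t, 1 ≤ t → ∀ᵐ ω ∂μ, ‖∇ f (x t ω)‖ ≤ Ginf ∧ ‖g t ω‖ ≤ Ginf) →
      -- unbiased and independent noise
      (∀ t, 1 ≤ t → ∀ ω, g t ω = ∇ f (x t ω) + η t ω) →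
      (∀ t, 1 ≤ t → ∫ ω, η t ω ∂μ = 0) →
      iIndepFun (fun t : ℕ => η (t + 1)) μ →
      -- `min_j (√v̂₁)_j ≥ c`
      (∀ᵐ ω ∂μ, ∀ j, c ≤ √(AdaX.correctedSecondMoment β₂ (fun s => g s ω) 1 j)) →
      (∀ t, 1 ≤ t → Integrable (fun ω => ‖∇ f (x t ω)‖ ^ 2) μ) ∧
      (∀ T : ℕ, 1 ≤ T →
        AdaX.minExpectedSqGrad μ f x T ≤
          Ginf / (α * √(T : ℝ)) *
            (C₁ * Ginf ^ 2 * α ^ 2 / c ^ 2 * (1 + Real.log T)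
              + C₂ * d * α / c + C₃ * d * α ^ 2 / c ^ 2 + C₄)) ∧
      (fun T : ℕ => AdaX.minExpectedSqGrad μ f x T) =O[atTop]
        (fun T : ℕ => Real.log T / √(T : ℝ)) := by
  have h1 : 0 < 1 - β₁ := sub_pos.2 hβ₁'
  -- These are the coefficients of `mul_minExpectedSqGrad_le` after division by `1 - β₁`: the `log
  -- T` term, then the telescoped `d * α / c` term. No `d * α² / c²` term arises, so `C₃ = 0`; the
  -- initial gap `f x₁ - inf f` goes into `C₄`.
  refine ⟨(L + L / (1 - β₁)) * ((1 + β₂) / β₂) / (1 - β₁), Ginf ^ 2 / (1 - β₁) ^ 2, 0, ?_⟩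
  intro d f x₁ α c hα hc hf hL hbdd
  refine ⟨(f x₁ - ⨅ y, f y) / (1 - β₁), ?_⟩
  intro β hβ Ω _ μ _ g x η hg hx hbound hη hmean hindep hgc
  subst hx
  have key : ∀ T : ℕ, 1 ≤ T →
      AdaX.minExpectedSqGrad μ f (AdaX.randomIterate α β β₂ x₁ g) T ≤
        Ginf / (α * √(T : ℝ)) *
          ((L + L / (1 - β₁)) * ((1 + β₂) / β₂) / (1 - β₁) * Ginf ^ 2 * α ^ 2 / c ^ 2 *
            (1 + Real.log T) + Ginf ^ 2 / (1 - β₁) ^ 2 * d * α / c + 0 * d * α ^ 2 / c ^ 2 +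
            (f x₁ - ⨅ y, f y) / (1 - β₁)) := by
    intro T hT
    have hT0 : (0 : ℝ) < T := by exact_mod_cast hT
    have h := AdaX.mul_minExpectedSqGrad_le hα hc hβ₂ hGinf hβ₁ hβ₁' hf hL hbdd hβ hg hbound hη
      hmean hindep hgc hT
    have hs : 0 < √(T : ℝ) := Real.sqrt_pos.2 hT0
    rw [mul_comm, ← le_div_iff₀ (by positivity)] at h
    refine h.trans (le_of_eq ?_)
    field_simp
    ring
  refine ⟨fun t ht => ?_, key, ?_⟩
  · obtain ⟨t, rfl⟩ : ∃ k, t = k + 1 := ⟨t - 1, by omega⟩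
    exact AdaX.integrable_norm_sq_comp hL.continuous.measurable
      (AdaX.measurable_randomIterate_succ α β₂ β x₁ t fun s h _ => hg s h)
      ((hbound (t + 1) ht).mono fun ω h => h.1)
  · refine AdaX.isBigO_log_div_sqrt
      (A := Ginf / α * ((L + L / (1 - β₁)) * ((1 + β₂) / β₂) / (1 - β₁) * Ginf ^ 2 * α ^ 2 / c ^ 2 +
        Ginf ^ 2 / (1 - β₁) ^ 2 * d * α / c + (f x₁ - ⨅ y, f y) / (1 - β₁)))
      (B := Ginf / α * ((L + L / (1 - β₁)) * ((1 + β₂) / β₂) / (1 - β₁) * Ginf ^ 2 * α ^ 2 / c ^ 2))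
      (AdaX.minExpectedSqGrad_nonneg f _) fun T hT => (key T hT).trans (le_of_eq ?_)
    rw [mul_comm α, ← div_div]
    ring
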